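/- Let $m\in\mathbb N$, $0<\varepsilon<\pi$ and $k_0\in\mathbb Z$. For $j=1,2$ let $\{A_j(k)\}_{k\in\mathbb Z}$, $\{B_j(k)\}_{k\in\mathbb Z}$ be sequences of self-adjoint complex $m\times m$ matrices with $A_j(k)>0$ (positive definite) for all $k$ and $\sup_{k}(\|A_j(k)\|+\|B_j(k)\|)<\infty$, and let $H_j$ be the Jacobi operator in $\ell^2(\mathbb Z)^m$, $$(H_jf)(k)=A_j(k)f(k+1)+A_j(k-1)f(k-1)+B_j(k)f(k),\qquad k\in\mathbb Z.$$ For $z\in\mathbb C$ let $\theta_j(z,\cdot,k_0),\phi_j(z,\cdot,k_0)$ be the $m\times m$ matrix solutions of $$A_j(k)\psi(k+1)+A_j(k-1)\psi(k-1)+(B_j(k)-zI_m)\psi(k)=0,\qquad k\in\mathbb Z,$$ with $\theta_j(z,k_0,k_0)=\phi_j(z,k_0+1,k_0)=I_m$ and $\phi_j(z,k_0,k_0)=\theta_j(z,k_0+1,k_0)=0$, and for $z\in\mathbb C\setminus\mathbb R$ let the Weyl–Titchmarsh matrices $M_{j,\pm}(z,k_0)$ be the unique $m\times m$ matrices such that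 $$\theta_j(z,\cdot,k_0)-\phi_j(z,\cdot,k_0)A_j(k_0)^{-1}M_{j,\pm}(z,k_0)\in\ell^2((k_0,\pm\infty)\cap\mathbb Z)^{m\times m}.$$ (i) If for some integer $N\ge 2$ $$\|M_{1,-}(z,k_0)-M_{2,-}(z,k_0)\|=O(|z|^{-N})\quad\text{as }|z|\to\infty\text{ along the ray }\arg(z)=\pi-\varepsilon,$$ then $$A_1(k_0-1-k)=A_2(k_0-1-k),\quad k=0,\dots,\lfloor N/2\rfloor-1,$$ $$B_1(k_0-k)=B_2(k_0-k),\quad k=0,\dots,\lfloor (N-1)/2\rfloor.$$ (ii) If for some integer $N\ge 2$ $$\|M_{1,+}(z,k_0)-M_{2,+}(z,k_0)\|=O(|z|^{-N})\quad\text{as }|z|\to\infty\text{ along the ray }\arg(z)=\pi-\varepsilon,$$ and $B_1(k_0)=B_2(k_0)$, then $$A_1(k_0+k)=A_2(k_0+k),\quad k=0,\dots,\lfloor N/2\rfloor-1,$$ $$B_1(k_0+k)=B_2(k_0+k),\quad k=0,\dots,\lfloor (N-1)/2\rfloor.$$ -/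

import Mathlib

open scoped Asymptotics ComplexOrder Matrix.Norms.L2Operator

/-- Coefficient sequences of a bounded `m × m` matrix-valued Jacobi operator
`(H f)(k) = A k f(k+1) + A (k-1) f(k-1) + B k f(k)` in `ℓ²(ℤ)^m`: every `A k` is (self-adjoint
and) positive definite, every `B k` is self-adjoint, and both sequences are uniformly bounded. -/
structure IsJacobiData {m : ℕ} (A B : ℤ → Matrix (Fin m) (Fin m) ℂ) : Prop where
  posDef : ∀ k, (A k).PosDef
  isHermitian : ∀ k, (B k).IsHermitian
  bounded : ∃ C : ℝ, ∀ k, ‖A k‖ + ‖B k‖ ≤ C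

/-- `ψ` is a matrix solution of the Jacobi equation with spectral parameter `z` on all of `ℤ`. -/
def IsJacobiSolution {m : ℕ} (A B : ℤ → Matrix (Fin m) (Fin m) ℂ) (z : ℂ)
    (ψ : ℤ → Matrix (Fin m) (Fin m) ℂ) : Prop :=
  ∀ k : ℤ, A k * ψ (k + 1) + A (k - 1) * ψ (k - 1)
    + (B k - z • (1 : Matrix (Fin m) (Fin m) ℂ)) * ψ k = 0

/-- The pair `(ψ (k₀ + n), ψ (k₀ + n + 1))` for the solution `ψ` with `ψ k₀ = u`,
`ψ (k₀ + 1) = v`. -/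
noncomputable def jacobiForward {m : ℕ} (A B : ℤ → Matrix (Fin m) (Fin m) ℂ) (z : ℂ) (k₀ : ℤ)
    (u v : Matrix (Fin m) (Fin m) ℂ) :
    ℕ → Matrix (Fin m) (Fin m) ℂ × Matrix (Fin m) (Fin m) ℂ
  | 0 => (u, v)
  | n + 1 =>
    ((jacobiForward A B z k₀ u v n).2,
      (A (k₀ + n + 1))⁻¹ *
        ((z • (1 : Matrix (Fin m) (Fin m) ℂ) - B (k₀ + n + 1)) * (jacobiForward A B z k₀ u v n).2
          - A (k₀ + n) * (jacobiForward A B z k₀ u v n).1))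

/-- The pair `(ψ (k₀ - n), ψ (k₀ - n + 1))` for the solution `ψ` with `ψ k₀ = u`,
`ψ (k₀ + 1) = v`. -/
noncomputable def jacobiBackward {m : ℕ} (A B : ℤ → Matrix (Fin m) (Fin m) ℂ) (z : ℂ) (k₀ : ℤ)
    (u v : Matrix (Fin m) (Fin m) ℂ) :
    ℕ → Matrix (Fin m) (Fin m) ℂ × Matrix (Fin m) (Fin m) ℂ
  | 0 => (u, v)
  | n + 1 =>
    ((A (k₀ - n - 1))⁻¹ *
        ((z • (1 : Matrix (Fin m) (Fin m) ℂ) - B (k₀ - n)) * (jacobiBackward A B z k₀ u v n).1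
          - A (k₀ - n) * (jacobiBackward A B z k₀ u v n).2),
      (jacobiBackward A B z k₀ u v n).1)

/-- The solution `ψ` of the Jacobi equation with `ψ k₀ = u`, `ψ (k₀ + 1) = v`. -/
noncomputable def jacobiSolution {m : ℕ} (A B : ℤ → Matrix (Fin m) (Fin m) ℂ) (z : ℂ) (k₀ : ℤ)
    (u v : Matrix (Fin m) (Fin m) ℂ) (k : ℤ) : Matrix (Fin m) (Fin m) ℂ :=
  if k₀ ≤ k then (jacobiForward A B z k₀ u v (k - k₀).toNat).1
  else (jacobiBackward A B z k₀ u v (k₀ - k).toNat).1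

theorem jacobiSolution_add {m : ℕ} (A B : ℤ → Matrix (Fin m) (Fin m) ℂ) (z : ℂ) (k₀ : ℤ)
    (u v : Matrix (Fin m) (Fin m) ℂ) (n : ℕ) :
    jacobiSolution A B z k₀ u v (k₀ + n) = (jacobiForward A B z k₀ u v n).1 := by
  simp [jacobiSolution]

theorem jacobiSolution_sub {m : ℕ} (A B : ℤ → Matrix (Fin m) (Fin m) ℂ) (z : ℂ) (k₀ : ℤ)
    (u v : Matrix (Fin m) (Fin m) ℂ) (n : ℕ) :
    jacobiSolution A B z k₀ u v (k₀ - n) = (jacobiBackward A B z k₀ u v n).1 := by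
  rcases n with _ | n
  · simp [jacobiSolution, jacobiForward, jacobiBackward]
  · have h : ¬ (k₀ ≤ k₀ - ((n + 1 : ℕ) : ℤ)) := by push_cast; omega
    rw [jacobiSolution, if_neg h]
    congr 2
    push_cast
    omega

theorem jacobiSolution_zero {m : ℕ} (A B : ℤ → Matrix (Fin m) (Fin m) ℂ) (z : ℂ) (k₀ : ℤ)
    (u v : Matrix (Fin m) (Fin m) ℂ) : jacobiSolution A B z k₀ u v k₀ = u := by
  simp [jacobiSolution, jacobiForward]

theorem jacobiSolution_one {m : ℕ} (A B : ℤ → Matrix (Fin m) (Fin m) ℂ) (z : ℂ) (k₀ : ℤ)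
    (u v : Matrix (Fin m) (Fin m) ℂ) : jacobiSolution A B z k₀ u v (k₀ + 1) = v := by
  simpa [jacobiForward] using jacobiSolution_add A B z k₀ u v 1

theorem jacobiSolution_isJacobiSolution {m : ℕ} {A B : ℤ → Matrix (Fin m) (Fin m) ℂ}
    (h : IsJacobiData A B) (z : ℂ) (k₀ : ℤ) (u v : Matrix (Fin m) (Fin m) ℂ) :
    IsJacobiSolution A B z (jacobiSolution A B z k₀ u v) := by
  have hA : ∀ k, IsUnit (A k).det := fun k => (Matrix.isUnit_iff_isUnit_det _).1 (h.posDef k).isUnit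
  intro k
  rcases lt_or_ge k₀ k with hk | hk
  · obtain ⟨n, rfl⟩ : ∃ n : ℕ, k = k₀ + n + 1 := ⟨(k - k₀ - 1).toNat, by omega⟩
    have e0 : k₀ + (n : ℤ) + 1 - 1 = k₀ + n := by ring
    have e1 := jacobiSolution_add A B z k₀ u v n
    have e2 := jacobiSolution_add A B z k₀ u v (n + 1)
    have e3 := jacobiSolution_add A B z k₀ u v (n + 2)
    rw [show k₀ + ((n + 1 : ℕ) : ℤ) = k₀ + n + 1 by push_cast; ring] at e2
    rw [show k₀ + ((n + 2 : ℕ) : ℤ) = k₀ + n + 1 + 1 by push_cast; ring] at e3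
    rw [e0, e1, e2, e3]
    simp only [jacobiForward]
    rw [Matrix.mul_nonsing_inv_cancel_left _ _ (hA _)]
    simp only [sub_mul]
    abel
  · obtain ⟨n, rfl⟩ : ∃ n : ℕ, k = k₀ - n := ⟨(k₀ - k).toNat, by omega⟩
    have e1 := jacobiSolution_sub A B z k₀ u v n
    have e2 := jacobiSolution_sub A B z k₀ u v (n + 1)
    rw [show k₀ - ((n + 1 : ℕ) : ℤ) = k₀ - n - 1 by push_cast; ring] at e2
    have e3 : jacobiSolution A B z k₀ u v (k₀ - n + 1) = (jacobiBackward A B z k₀ u v n).2 := by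
      rcases n with _ | n
      · simpa [jacobiBackward] using jacobiSolution_one A B z k₀ u v
      · rw [show k₀ - ((n + 1 : ℕ) : ℤ) + 1 = k₀ - n by push_cast; ring, jacobiSolution_sub]
        rfl
    rw [e1, e2, e3]
    simp only [jacobiBackward]
    rw [Matrix.mul_nonsing_inv_cancel_left _ _ (hA _)]
    simp only [sub_mul]
    abel

/-- The normalized solution `θ(z, ·, k₀)`: `θ(k₀) = 1`, `θ(k₀ + 1) = 0`. -/
noncomputable def thetaSolution {m : ℕ} (A B : ℤ → Matrix (Fin m) (Fin m) ℂ) (z : ℂ) (k₀ : ℤ) :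
    ℤ → Matrix (Fin m) (Fin m) ℂ :=
  jacobiSolution A B z k₀ 1 0

/-- The normalized solution `φ(z, ·, k₀)`: `φ(k₀) = 0`, `φ(k₀ + 1) = 1`. -/
noncomputable def phiSolution {m : ℕ} (A B : ℤ → Matrix (Fin m) (Fin m) ℂ) (z : ℂ) (k₀ : ℤ) :
    ℤ → Matrix (Fin m) (Fin m) ℂ :=
  jacobiSolution A B z k₀ 0 1

/-- `M` is a Weyl–Titchmarsh matrix for the set of sites `S` (the half-line to the right or to
the left of `k₀`): the solution `ψ = θ - φ A(k₀)⁻¹ M` is square summable over `S`. -/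
def IsWeylMatrix {m : ℕ} (A B : ℤ → Matrix (Fin m) (Fin m) ℂ) (S : Set ℤ) (z : ℂ) (k₀ : ℤ)
    (M : Matrix (Fin m) (Fin m) ℂ) : Prop :=
  Summable fun k : S => ‖thetaSolution A B z k₀ k - phiSolution A B z k₀ k * (A k₀)⁻¹ * M‖ ^ 2

open Classical in
/-- The matrix determined by `IsWeylMatrix`. For bounded Jacobi data, a half-line `S` and
non-real `z` there is exactly one such matrix (limit point case); elsewhere the value is
irrelevant. -/
noncomputable def weylMatrix {m : ℕ} (A B : ℤ → Matrix (Fin m) (Fin m) ℂ) (S : Set ℤ) (z : ℂ)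
    (k₀ : ℤ) : Matrix (Fin m) (Fin m) ℂ :=
  if h : ∃ M, IsWeylMatrix A B S z k₀ M then h.choose else 0

/-- The right half-line Weyl–Titchmarsh matrix `M₊(z, k₀)`. -/
noncomputable def weylPlus {m : ℕ} (A B : ℤ → Matrix (Fin m) (Fin m) ℂ) (z : ℂ) (k₀ : ℤ) :
    Matrix (Fin m) (Fin m) ℂ :=
  weylMatrix A B (Set.Ioi k₀) z k₀

/-- The left half-line Weyl–Titchmarsh matrix `M₋(z, k₀)`. -/
noncomputable def weylMinus {m : ℕ} (A B : ℤ → Matrix (Fin m) (Fin m) ℂ) (z : ℂ) (k₀ : ℤ) :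
    Matrix (Fin m) (Fin m) ℂ :=
  weylMatrix A B (Set.Iio k₀) z k₀

/-- The filter `|z| → ∞` along the ray `arg z = α`. -/
noncomputable def rayAtInfinity (α : ℝ) : Filter ℂ :=
  Bornology.cobounded ℂ ⊓ Filter.principal {z : ℂ | z.arg = α}

/-! For large `z` each half-line has one bounded solution `v` with `v 0 = 1`; it decays, and `F = a
0 * v 1` tends to 0. Shifting by one site gives the Riccati relation `P * (a 0)⁻¹ * F = a 0`, where
`P = z - b 0 - F'` and `F'` belongs to the shifted data. Hence `z F → (a 0)²`, which determines `a
0` by uniqueness of positive square roots. Once `a 0` is common, `P₂ - P₁ = P₁ (a 0)⁻¹ (F₁ - F₂) (a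
0)⁻¹ P₂` with `P₁`, `P₂` of size `|z|`, so `(b₁ 0 + F₁') - (b₂ 0 + F₂')` is smaller than
`|z|^(-(n-2))` up to a constant. Its limit determines `b 0`, and induction peels off one site per
two powers of `z` (`IsHalfLineWeyl.isBigO_shift`, `IsHalfLineWeyl.coeff_eq`). The Weyl matrices fit
this scheme: `-M₊` is such an `F`, and so is `M₋ - B k₀ + z`. Thus `M₋` sees `B k₀` while `M₊` does
not, whence the extra hypothesis in (ii). -/

open Filter Topology

/-! ### Bounded half-line solutions for large spectral parameter -/

section HalfLine

variable {m : ℕ}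

/-- `v` solves the half-line Jacobi equation with coefficients `a`, `b` and spectral
parameter `z`. -/
def IsHalfLineSolution (a b : ℕ → Matrix (Fin m) (Fin m) ℂ) (z : ℂ)
    (v : ℕ → Matrix (Fin m) (Fin m) ℂ) : Prop :=
  ∀ n, a n * v n + a (n + 1) * v (n + 2)
    + (b n - z • (1 : Matrix (Fin m) (Fin m) ℂ)) * v (n + 1) = 0

/-- Half-line Jacobi coefficients: `a` is positive definite and both sequences are bounded
by `C`. -/
structure IsHalfLineData (a b : ℕ → Matrix (Fin m) (Fin m) ℂ) (C : ℝ) : Prop where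
  posDef : ∀ n, (a n).PosDef
  pos : 0 < C
  norm_left_le : ∀ n, ‖a n‖ ≤ C
  norm_right_le : ∀ n, ‖b n‖ ≤ C

variable {a b a₁ b₁ a₂ b₂ : ℕ → Matrix (Fin m) (Fin m) ℂ} {C C₁ C₂ : ℝ} {z : ℂ}
  {v w : ℕ → Matrix (Fin m) (Fin m) ℂ}

theorem IsHalfLineData.shift (h : IsHalfLineData a b C) :
    IsHalfLineData (fun n => a (n + 1)) (fun n => b (n + 1)) C :=
  ⟨fun _ => h.posDef _, h.pos, fun _ => h.norm_left_le _, fun _ => h.norm_right_le _⟩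

theorem IsHalfLineData.isUnit_det (h : IsHalfLineData a b C) (n : ℕ) : IsUnit (a n).det :=
  (Matrix.isUnit_iff_isUnit_det _).1 (h.posDef n).isUnit

theorem IsHalfLineSolution.shift (h : IsHalfLineSolution a b z v) :
    IsHalfLineSolution (fun n => a (n + 1)) (fun n => b (n + 1)) z (fun n => v (n + 1)) :=
  fun n => h (n + 1)

theorem IsHalfLineSolution.mul_right (h : IsHalfLineSolution a b z v)
    (X : Matrix (Fin m) (Fin m) ℂ) : IsHalfLineSolution a b z (fun n => v n * X) := by
  intro n
  have := congrArg (· * X) (h n)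
  simpa only [add_mul, mul_assoc, zero_mul] using this

theorem IsHalfLineSolution.sub (hv : IsHalfLineSolution a b z v)
    (hw : IsHalfLineSolution a b z w) : IsHalfLineSolution a b z (fun n => v n - w n) := by
  intro n
  have := congrArg₂ (· - ·) (hv n) (hw n)
  simp only [sub_zero] at this
  rw [← this]
  simp only [mul_sub]
  abel

theorem IsHalfLineSolution.norm_le (h : IsHalfLineData a b C) (hv : IsHalfLineSolution a b z v)
    (n : ℕ) : ‖z‖ * ‖v (n + 1)‖ ≤ C * ‖v n‖ + C * ‖v (n + 2)‖ + C * ‖v (n + 1)‖ := by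
  have e : z • v (n + 1) = a n * v n + a (n + 1) * v (n + 2) + b n * v (n + 1) := by
    have := hv n
    rw [sub_mul, smul_mul_assoc, one_mul] at this
    rw [← sub_eq_zero, ← neg_eq_zero, ← this]
    abel
  rw [← norm_smul, e]
  refine (norm_add₃_le).trans ?_
  gcongr
  · exact (norm_mul_le _ _).trans (by gcongr; exact h.norm_left_le _)
  · exact (norm_mul_le _ _).trans (by gcongr; exact h.norm_left_le _)
  · exact (norm_mul_le _ _).trans (by gcongr; exact h.norm_right_le _)

/-- Bounded solutions decay when the spectral parameter is large. -/
theorem IsHalfLineSolution.norm_succ_le (h : IsHalfLineData a b C)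
    (hv : IsHalfLineSolution a b z v) (hz : 8 * C ≤ ‖z‖) {K : ℝ} (hK : ∀ n, ‖v n‖ ≤ K) (n : ℕ) :
    ‖z‖ * ‖v (n + 1)‖ ≤ 2 * C * ‖v n‖ := by
  have hC := h.pos
  by_contra! hn
  -- One failure of the bound propagates: the recurrence with `8 * C ≤ ‖z‖` then forces the norm to
  -- at least double at every step, contradicting boundedness.
  have growth : ∀ j, 2 * C * ‖v (n + j)‖ < ‖z‖ * ‖v (n + j + 1)‖ ∧
      2 ^ j * ‖v (n + 1)‖ ≤ ‖v (n + j + 1)‖ := by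
    intro j
    induction j with
    | zero => exact ⟨hn, by simp⟩
    | succ j ih =>
      obtain ⟨h1, h2⟩ := ih
      have h3 := hv.norm_le h (n + j)
      have h4 : 8 * C * ‖v (n + j + 1)‖ ≤ ‖z‖ * ‖v (n + j + 1)‖ := by gcongr
      have h5 : 2 * ‖v (n + j + 1)‖ ≤ ‖v (n + j + 2)‖ := by
        refine le_of_mul_le_mul_left ?_ hC
        linarith [mul_nonneg hC.le (norm_nonneg (v (n + j + 1)))]
      have hp : 0 < ‖v (n + j + 1)‖ := by
        by_contra! hp
        have : ‖v (n + j + 1)‖ = 0 := le_antisymm hp (norm_nonneg _)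
        rw [this, mul_zero] at h1
        exact absurd h1 (not_lt.2 (by positivity))
      refine ⟨?_, ?_⟩
      · have h6 : 8 * C * ‖v (n + j + 2)‖ ≤ ‖z‖ * ‖v (n + j + 2)‖ := by gcongr
        have h7 : C * (2 * ‖v (n + j + 1)‖) ≤ C * ‖v (n + j + 2)‖ := by gcongr
        have h8 : 0 < C * ‖v (n + j + 1)‖ := by positivity
        change 2 * C * ‖v (n + j + 1)‖ < ‖z‖ * ‖v (n + j + 2)‖
        linarith
      · change _ ≤ ‖v (n + j + 2)‖
        rw [pow_succ]
        linarith
  have hp : 0 < ‖v (n + 1)‖ := by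
    by_contra! hp
    have : ‖v (n + 1)‖ = 0 := le_antisymm hp (norm_nonneg _)
    rw [this, mul_zero] at hn
    exact absurd hn (not_lt.2 (by positivity))
  obtain ⟨j, hj⟩ := pow_unbounded_of_one_lt (K / ‖v (n + 1)‖) (one_lt_two)
  rw [div_lt_iff₀ hp] at hj
  linarith [(growth j).2, hK (n + j + 1)]

theorem IsHalfLineSolution.norm_succ_le_half (h : IsHalfLineData a b C)
    (hv : IsHalfLineSolution a b z v) (hz : 8 * C ≤ ‖z‖) {K : ℝ} (hK : ∀ n, ‖v n‖ ≤ K) (n : ℕ) :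
    ‖v (n + 1)‖ ≤ 1 / 2 * ‖v n‖ := by
  have hC := h.pos
  have h1 := hv.norm_succ_le h hz hK n
  have h2 : 8 * C * ‖v (n + 1)‖ ≤ ‖z‖ * ‖v (n + 1)‖ := by gcongr
  refine le_of_mul_le_mul_left ?_ hC
  linarith [mul_nonneg hC.le (norm_nonneg (v n))]

theorem IsHalfLineSolution.summable_norm_sq (h : IsHalfLineData a b C)
    (hv : IsHalfLineSolution a b z v) (hz : 8 * C ≤ ‖z‖) {K : ℝ} (hK : ∀ n, ‖v n‖ ≤ K) :
    Summable fun n => ‖v n‖ ^ 2 := by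
  have hle : ∀ n, ‖v n‖ ≤ (1 / 2 : ℝ) ^ n * ‖v 0‖ := by
    intro n
    induction n with
    | zero => simp
    | succ n ih =>
      have := hv.norm_succ_le_half h hz hK n
      rw [pow_succ]
      linarith
  refine Summable.of_nonneg_of_le (fun n => by positivity)
    (fun n => pow_le_pow_left₀ (norm_nonneg _) (hle n) 2) ?_
  have : (fun n : ℕ => ((1 / 2 : ℝ) ^ n * ‖v 0‖) ^ 2) = fun n => (1 / 4 : ℝ) ^ n * ‖v 0‖ ^ 2 := by
    funext n
    rw [mul_pow, ← pow_mul, mul_comm n 2, pow_mul]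
    norm_num
  rw [this]
  exact (summable_geometric_of_lt_one (by norm_num) (by norm_num)).mul_right _

/-- The decay estimate applied to the difference propagates its zero at site 0. This stands in for
the limit point property. -/
theorem IsHalfLineSolution.eq_of_bounded (h : IsHalfLineData a b C)
    (hv : IsHalfLineSolution a b z v) (hw : IsHalfLineSolution a b z w) (hz : 8 * C ≤ ‖z‖)
    {K L : ℝ} (hK : ∀ n, ‖v n‖ ≤ K) (hL : ∀ n, ‖w n‖ ≤ L) (h0 : v 0 = w 0) (n : ℕ) :
    v n = w n := by
  have hb : ∀ n, ‖v n - w n‖ ≤ K + L := fun n =>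
    (norm_sub_le _ _).trans (add_le_add (hK n) (hL n))
  induction n with
  | zero => exact h0
  | succ n ih =>
    have := (hv.sub hw).norm_succ_le_half h hz hb n
    simp only [ih, sub_self, norm_zero, mul_zero] at this
    exact sub_eq_zero.1 (norm_le_zero_iff.1 this)

theorem IsHalfLineSolution.eq_of_initial (h : IsHalfLineData a b C)
    (hv : IsHalfLineSolution a b z v) (hw : IsHalfLineSolution a b z w)
    (h0 : v 0 = w 0) (h1 : v 1 = w 1) (n : ℕ) : v n = w n := by
  suffices H : v n = w n ∧ v (n + 1) = w (n + 1) from H.1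
  induction n with
  | zero => exact ⟨h0, h1⟩
  | succ n ih =>
    refine ⟨ih.2, ?_⟩
    have e := (hv n).trans (hw n).symm
    rw [ih.1, ih.2, add_left_inj, add_right_inj] at e
    have := congrArg ((a (n + 1))⁻¹ * ·) e
    simpa only [Matrix.nonsing_inv_mul_cancel_left _ _ (h.isUnit_det (n + 1))] using this

/-- Existence of the normalized bounded solution for a large spectral parameter. -/
theorem IsHalfLineData.exists_bounded (h : IsHalfLineData a b C) (hz : 8 * C ≤ ‖z‖) :
    ∃ v, IsHalfLineSolution a b z v ∧ v 0 = 1 ∧ ∃ K : ℝ, ∀ n, ‖v n‖ ≤ K := by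
  have hC := h.pos
  have hz0 : 0 < ‖z‖ := by linarith
  have hzne : z ≠ 0 := norm_pos_iff.1 hz0
  -- The unknown is `u n = v (n + 1)`; `prev` prepends the boundary value 1, and solving the
  -- equation for `z • u` makes `u` a fixed point of `R`.
  let prev : (ℕ → Matrix (Fin m) (Fin m) ℂ) → ℕ → Matrix (Fin m) (Fin m) ℂ := fun u n =>
    Nat.casesOn n 1 u
  let R : (ℕ → Matrix (Fin m) (Fin m) ℂ) → ℕ → Matrix (Fin m) (Fin m) ℂ := fun u n =>
    z⁻¹ • (a n * prev u n + a (n + 1) * u (n + 1) + b n * u n)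
  -- Three terms of size `C * D` against `8 * C ≤ ‖z‖`: this yields both boundedness of `R u` and
  -- the contraction constant.
  have combine : ∀ (n : ℕ) (x y t : Matrix (Fin m) (Fin m) ℂ) (D : ℝ), 0 ≤ D → ‖x‖ ≤ D →
      ‖y‖ ≤ D → ‖t‖ ≤ D → ‖z⁻¹ • (a n * x + a (n + 1) * y + b n * t)‖ ≤ 1 / 2 * D := by
    intro n x y t D hD hx hy ht
    rw [norm_smul, norm_inv, inv_mul_le_iff₀ hz0]
    have e1 : ‖a n * x‖ ≤ C * D := (norm_mul_le _ _).trans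
      (mul_le_mul (h.norm_left_le _) hx (norm_nonneg _) hC.le)
    have e2 : ‖a (n + 1) * y‖ ≤ C * D := (norm_mul_le _ _).trans
      (mul_le_mul (h.norm_left_le _) hy (norm_nonneg _) hC.le)
    have e3 : ‖b n * t‖ ≤ C * D := (norm_mul_le _ _).trans
      (mul_le_mul (h.norm_right_le _) ht (norm_nonneg _) hC.le)
    have e4 : 8 * C * D ≤ ‖z‖ * D := by gcongr
    have e5 : 0 ≤ C * D := by positivity
    refine (norm_add₃_le).trans ?_
    linarith
  have bdd : ∀ u : BoundedContinuousFunction ℕ (Matrix (Fin m) (Fin m) ℂ), ∀ n,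
      ‖R u n‖ ≤ 1 / 2 * (‖u‖ + ‖(1 : Matrix (Fin m) (Fin m) ℂ)‖) := by
    intro u n
    have hu : ∀ n, ‖u n‖ ≤ ‖u‖ + ‖(1 : Matrix (Fin m) (Fin m) ℂ)‖ := fun n =>
      (u.norm_coe_le_norm n).trans (le_add_of_nonneg_right (norm_nonneg _))
    refine combine n _ _ _ _ (by positivity) ?_ (hu _) (hu _)
    cases n with
    | zero => exact le_add_of_nonneg_left (norm_nonneg _)
    | succ n => exact hu n
  let T : BoundedContinuousFunction ℕ (Matrix (Fin m) (Fin m) ℂ) →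
      BoundedContinuousFunction ℕ (Matrix (Fin m) (Fin m) ℂ) := fun u =>
    BoundedContinuousFunction.ofNormedAddCommGroupDiscrete (R u) _ (bdd u)
  have hT : ContractingWith (1 / 2) T := by
    refine ⟨by norm_num, LipschitzWith.of_dist_le_mul fun u u' => ?_⟩
    refine (BoundedContinuousFunction.dist_le (by positivity)).2 fun n => ?_
    change dist (R u n) (R u' n) ≤ _
    rw [dist_eq_norm]
    have e : R u n - R u' n = z⁻¹ • (a n * (prev u n - prev u' n)
        + a (n + 1) * (u (n + 1) - u' (n + 1)) + b n * (u n - u' n)) := by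
      simp only [R, ← smul_sub, mul_sub]
      congr 1
      abel
    have hd : ∀ n, ‖u n - u' n‖ ≤ dist u u' := fun n => by
      rw [← dist_eq_norm]
      exact BoundedContinuousFunction.dist_coe_le_dist n
    rw [e]
    push_cast
    refine combine n _ _ _ _ dist_nonneg ?_ (hd _) (hd _)
    cases n with
    | zero => simp [prev]
    | succ n => exact hd n
  have : Nonempty (BoundedContinuousFunction ℕ (Matrix (Fin m) (Fin m) ℂ)) := ⟨0⟩
  let u := hT.fixedPoint T
  have hu : ∀ n, R u n = u n := fun n => DFunLike.congr_fun hT.fixedPoint_isFixedPt n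
  refine ⟨prev u, ?_, rfl, ‖u‖ + ‖(1 : Matrix (Fin m) (Fin m) ℂ)‖, ?_⟩
  · intro n
    have e : z • u n = a n * prev u n + a (n + 1) * u (n + 1) + b n * u n := by
      rw [← hu n]
      simp only [R]
      rw [smul_inv_smul₀ hzne]
      simp only [R, hu n]
    change a n * prev u n + a (n + 1) * u (n + 1) + (b n - z • 1) * u n = 0
    rw [sub_mul, smul_mul_assoc, one_mul, e]
    abel
  · intro n
    cases n with
    | zero => exact le_add_of_nonneg_left (norm_nonneg _)
    | succ n => exact (u.norm_coe_le_norm n).trans (le_add_of_nonneg_right (norm_nonneg _))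

/-! ### Half-line Weyl functions: Riccati relation and coefficient recovery -/

/-- `F` is, near infinity, the matrix `a 0 * v 1` of the bounded solution `v` with `v 0 = 1`. -/
def IsHalfLineWeyl (a b : ℕ → Matrix (Fin m) (Fin m) ℂ) (F : ℂ → Matrix (Fin m) (Fin m) ℂ) :
    Prop :=
  ∀ᶠ z in Bornology.cobounded ℂ, ∃ v, IsHalfLineSolution a b z v ∧ v 0 = 1 ∧
    (∃ K : ℝ, ∀ n, ‖v n‖ ≤ K) ∧ F z = a 0 * v 1

theorem eventually_le_norm_cobounded (r : ℝ) : ∀ᶠ z in Bornology.cobounded ℂ, r ≤ ‖z‖ :=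
  tendsto_norm_cobounded_atTop.eventually_ge_atTop r

theorem IsHalfLineData.exists_isHalfLineWeyl (h : IsHalfLineData a b C) :
    ∃ F, IsHalfLineWeyl a b F := by
  have : ∀ z : ℂ, ∃ X, 8 * C ≤ ‖z‖ → ∃ v, IsHalfLineSolution a b z v ∧ v 0 = 1 ∧
      (∃ K : ℝ, ∀ n, ‖v n‖ ≤ K) ∧ X = a 0 * v 1 := by
    intro z
    by_cases hz : 8 * C ≤ ‖z‖
    · obtain ⟨v, h1, h2, h3⟩ := h.exists_bounded hz
      exact ⟨a 0 * v 1, fun _ => ⟨v, h1, h2, h3, rfl⟩⟩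
    · exact ⟨0, fun h => absurd h hz⟩
  choose F hF using this
  exact ⟨F, (eventually_le_norm_cobounded (8 * C)).mono hF⟩

variable {F F' F₁ F₂ : ℂ → Matrix (Fin m) (Fin m) ℂ} {l : Filter ℂ}

theorem IsHalfLineWeyl.isBigO (h : IsHalfLineData a b C) (hF : IsHalfLineWeyl a b F) :
    F =O[Bornology.cobounded ℂ] fun z => z⁻¹ := by
  have hC := h.pos
  refine Asymptotics.IsBigO.of_bound (C * (2 * C * ‖(1 : Matrix (Fin m) (Fin m) ℂ)‖)) ?_
  filter_upwards [hF, eventually_le_norm_cobounded (8 * C)] with z ⟨v, h1, h2, ⟨K, hK⟩, h4⟩ hz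
  have hz0 : 0 < ‖z‖ := by linarith
  have := h1.norm_succ_le h hz hK 0
  rw [h2, zero_add] at this
  rw [h4, norm_inv, ← div_eq_mul_inv, le_div_iff₀ hz0]
  calc ‖a 0 * v 1‖ * ‖z‖ ≤ C * ‖v 1‖ * ‖z‖ := by
        gcongr
        exact (norm_mul_le _ _).trans (by gcongr; exact h.norm_left_le _)
    _ = C * (‖z‖ * ‖v 1‖) := by ring
    _ ≤ _ := by gcongr

theorem IsHalfLineWeyl.tendsto_zero (h : IsHalfLineData a b C) (hF : IsHalfLineWeyl a b F) :
    Tendsto F (Bornology.cobounded ℂ) (𝓝 0) :=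
  (hF.isBigO h).trans_tendsto tendsto_inv₀_cobounded

/-- The Riccati recursion for the half-line Weyl matrices. -/
theorem IsHalfLineWeyl.riccati (h : IsHalfLineData a b C) (hF : IsHalfLineWeyl a b F)
    (hF' : IsHalfLineWeyl (fun n => a (n + 1)) (fun n => b (n + 1)) F') :
    ∀ᶠ z in Bornology.cobounded ℂ,
      (z • (1 : Matrix (Fin m) (Fin m) ℂ) - b 0 - F' z) * ((a 0)⁻¹ * F z) = a 0 := by
  filter_upwards [hF, hF', eventually_le_norm_cobounded (8 * C)] with z
    ⟨v, h1, h2, ⟨K, hK⟩, h4⟩ ⟨w, g1, g2, ⟨L, hL⟩, g4⟩ hz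
  -- The shifted `v` is the normalized bounded solution of the shifted problem times `v 1`.
  have e := IsHalfLineSolution.eq_of_bounded h.shift h1.shift (g1.mul_right (v 1)) hz
    (fun n => hK (n + 1)) (fun n => (norm_mul_le _ _).trans
      (mul_le_mul_of_nonneg_right (hL n) (norm_nonneg _))) (by simp [g2]) 1
  have e0 := h1 0
  simp only [zero_add, one_add_one_eq_two] at e e0 g4
  rw [h4, g4, Matrix.nonsing_inv_mul_cancel_left _ _ (h.isUnit_det 0)]
  rw [h2, e, mul_one] at e0
  rw [← sub_eq_zero, ← neg_eq_zero, ← e0]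
  simp only [sub_mul, mul_assoc]
  abel

theorem IsHalfLineWeyl.tendsto_smul (h : IsHalfLineData a b C) (hF : IsHalfLineWeyl a b F) :
    Tendsto (fun z => z • F z) (Bornology.cobounded ℂ) (𝓝 (a 0 * a 0)) := by
  obtain ⟨F', hF'⟩ := h.shift.exists_isHalfLineWeyl
  have t := hF.tendsto_zero h
  have t' := hF'.tendsto_zero h.shift
  have : Tendsto (fun z => a 0 * (a 0 + (b 0 + F' z) * ((a 0)⁻¹ * F z))) (Bornology.cobounded ℂ)
      (𝓝 (a 0 * (a 0 + (b 0 + 0) * ((a 0)⁻¹ * 0)))) :=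
    (((t'.const_add _).mul (t.const_mul _)).const_add _).const_mul _
  simp only [mul_zero, add_zero] at this
  refine this.congr' ?_
  filter_upwards [hF.riccati h hF'] with z hz
  have e : z • ((a 0)⁻¹ * F z) = a 0 + (b 0 + F' z) * ((a 0)⁻¹ * F z) := by
    nth_rewrite 2 [← hz]
    simp only [sub_mul, add_mul, smul_mul_assoc, one_mul]
    abel
  rw [← e, mul_smul_comm, Matrix.mul_nonsing_inv_cancel_left _ _ (h.isUnit_det 0)]

open scoped MatrixOrder in
-- Both are the unique nonnegative square root of the same matrix.
theorem Matrix.PosDef.eq_of_mul_self_eq {A B : Matrix (Fin m) (Fin m) ℂ} (hA : A.PosDef)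
    (hB : B.PosDef) (h : A * A = B * B) : A = B := by
  rw [← CFC.sqrt_mul_self A hA.posSemidef.nonneg, ← CFC.sqrt_mul_self B hB.posSemidef.nonneg, h]

theorem tendsto_zero_of_isBigO_zpow {E : Type*} [NormedAddCommGroup E] {f : ℂ → E} {n : ℤ}
    (hl : l ≤ Bornology.cobounded ℂ) (hf : f =O[l] fun z => ‖z‖ ^ (-n)) (hn : 0 < n) :
    Tendsto f l (𝓝 0) :=
  hf.trans_tendsto ((tendsto_zpow_atTop_zero (by omega)).comp (tendsto_norm_cobounded_atTop.mono_left hl))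

theorem IsHalfLineWeyl.left_zero_eq [l.NeBot] (hl : l ≤ Bornology.cobounded ℂ)
    (h₁ : IsHalfLineData a₁ b₁ C₁) (h₂ : IsHalfLineData a₂ b₂ C₂)
    (hF₁ : IsHalfLineWeyl a₁ b₁ F₁) (hF₂ : IsHalfLineWeyl a₂ b₂ F₂) {n : ℤ} (hn : 2 ≤ n)
    (hO : (fun z => F₁ z - F₂ z) =O[l] fun z => ‖z‖ ^ (-n)) : a₁ 0 = a₂ 0 := by
  refine (h₁.posDef 0).eq_of_mul_self_eq (h₂.posDef 0) (sub_eq_zero.1 ?_)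
  have t := ((hF₁.tendsto_smul h₁).sub (hF₂.tendsto_smul h₂)).mono_left hl
  refine tendsto_nhds_unique t (tendsto_zero_of_isBigO_zpow (n := n - 1) hl ?_ (by omega))
  have hz : (fun z : ℂ => z) =O[l] fun z => ‖z‖ := Asymptotics.isBigO_refl _ _ |>.norm_right
  refine (hz.smul hO).congr' (.of_forall fun z => smul_sub _ _ _) ?_
  filter_upwards [hl (eventually_le_norm_cobounded 1)] with z h1
  have : ‖z‖ ≠ 0 := by linarith
  rw [smul_eq_mul, ← zpow_one_add₀ this]
  congr 1
  ring

/-- Two powers are lost to the factors `P₁` and `P₂`, each `O(‖z‖)`. The `b` terms stay inside the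
estimate because their equality is deduced from it. -/
theorem IsHalfLineWeyl.isBigO_shift (hl : l ≤ Bornology.cobounded ℂ)
    (h₁ : IsHalfLineData a₁ b₁ C₁) (h₂ : IsHalfLineData a₂ b₂ C₂)
    (hF₁ : IsHalfLineWeyl a₁ b₁ F₁) (hF₂ : IsHalfLineWeyl a₂ b₂ F₂)
    {G₁ G₂ : ℂ → Matrix (Fin m) (Fin m) ℂ}
    (hG₁ : IsHalfLineWeyl (fun n => a₁ (n + 1)) (fun n => b₁ (n + 1)) G₁)
    (hG₂ : IsHalfLineWeyl (fun n => a₂ (n + 1)) (fun n => b₂ (n + 1)) G₂) {n : ℤ}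
    (ha : a₁ 0 = a₂ 0) (hO : (fun z => F₁ z - F₂ z) =O[l] fun z => ‖z‖ ^ (-n)) :
    (fun z => (b₁ 0 + G₁ z) - (b₂ 0 + G₂ z)) =O[l] fun z => ‖z‖ ^ (-(n - 2)) := by
  have linear : ∀ {a b : ℕ → Matrix (Fin m) (Fin m) ℂ} {C : ℝ}
      {G : ℂ → Matrix (Fin m) (Fin m) ℂ}, IsHalfLineData a b C → IsHalfLineWeyl a b G →
      ∀ B : Matrix (Fin m) (Fin m) ℂ,
      (fun z => z • (1 : Matrix (Fin m) (Fin m) ℂ) - B - G z) =O[l] fun z => ‖z‖ := by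
    intro a b C G h hG B
    have hone : (fun _ : ℂ => (1 : ℝ)) =O[l] fun z => ‖z‖ := by
      refine Asymptotics.IsBigO.of_bound 1 ?_
      filter_upwards [hl (eventually_le_norm_cobounded 1)] with z h1
      simpa using h1
    have hz : (fun z : ℂ => z • (1 : Matrix (Fin m) (Fin m) ℂ)) =O[l] fun z => ‖z‖ := by
      refine Asymptotics.IsBigO.of_bound ‖(1 : Matrix (Fin m) (Fin m) ℂ)‖ (.of_forall fun z => ?_)
      rw [norm_smul, norm_norm, mul_comm]
    exact (hz.sub ((Asymptotics.isBigO_const_one ℝ B l).trans hone)).sub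
      ((((hG.tendsto_zero h).mono_left hl).isBigO_one ℝ).trans hone)
  have key := ((linear h₁.shift hG₁ (b₁ 0)).mul ((Asymptotics.isBigO_const_one ℝ (a₁ 0)⁻¹ l).mul
    ((hO.mul (Asymptotics.isBigO_const_one ℝ (a₁ 0)⁻¹ l)).mul (linear h₂.shift hG₂ (b₂ 0)))))
  refine key.congr' ?_ ?_
  · filter_upwards [hl (hF₁.riccati h₁ hG₁), hl (hF₂.riccati h₂ hG₂)] with z e₁ e₂
    rw [← ha] at e₂
    have hu := h₁.isUnit_det 0
    set P₁ := z • (1 : Matrix (Fin m) (Fin m) ℂ) - b₁ 0 - G₁ z with hP₁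
    set P₂ := z • (1 : Matrix (Fin m) (Fin m) ℂ) - b₂ 0 - G₂ z with hP₂
    -- The Riccati relation gives a right inverse of the square matrix `P₂`, which is also a left
    -- inverse.
    have e₃ : (a₁ 0)⁻¹ * F₂ z * (a₁ 0)⁻¹ * P₂ = 1 := by
      refine mul_eq_one_comm.1 ?_
      rw [← mul_assoc, e₂, Matrix.mul_nonsing_inv _ hu]
    have e₄ : P₁ * ((a₁ 0)⁻¹ * ((F₁ z - F₂ z) * (a₁ 0)⁻¹ * P₂)) = P₂ - P₁ := by
      have : P₁ * ((a₁ 0)⁻¹ * ((F₁ z - F₂ z) * (a₁ 0)⁻¹ * P₂))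
          = P₁ * ((a₁ 0)⁻¹ * F₁ z) * (a₁ 0)⁻¹ * P₂
            - P₁ * ((a₁ 0)⁻¹ * F₂ z * (a₁ 0)⁻¹ * P₂) := by
        simp only [sub_mul, mul_sub, mul_assoc]
      rw [this, e₁, e₃, Matrix.mul_nonsing_inv _ hu, one_mul, mul_one]
    rw [e₄, hP₁, hP₂]
    abel
  · filter_upwards [hl (eventually_le_norm_cobounded 1)] with z h1
    have : ‖z‖ ≠ 0 := by linarith
    rw [show -(n - 2) = 1 + (-n + 1) by ring, zpow_one_add₀ this, zpow_add_one₀ this]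
    ring

/-- Weyl functions vanish at infinity, so only the constants survive. These are arbitrary so that `B
k₀` can be read off `M₋` too. -/
theorem IsHalfLineWeyl.right_zero_eq [l.NeBot] (hl : l ≤ Bornology.cobounded ℂ)
    (h₁ : IsHalfLineData a₁ b₁ C₁) (h₂ : IsHalfLineData a₂ b₂ C₂)
    (hF₁ : IsHalfLineWeyl a₁ b₁ F₁) (hF₂ : IsHalfLineWeyl a₂ b₂ F₂)
    {n : ℤ} (hn : 0 < n) {B₁ B₂ : Matrix (Fin m) (Fin m) ℂ}
    (hO : (fun z => (B₁ + F₁ z) - (B₂ + F₂ z)) =O[l] fun z => ‖z‖ ^ (-n)) : B₁ = B₂ := by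
  have t := (((hF₁.tendsto_zero h₁).const_add B₁).sub
    ((hF₂.tendsto_zero h₂).const_add B₂)).mono_left hl
  have := tendsto_nhds_unique t (tendsto_zero_of_isBigO_zpow hl hO hn)
  simpa [sub_eq_zero] using this

/-- Local Borg–Marchenko uniqueness on the half-line. -/
theorem IsHalfLineWeyl.coeff_eq [l.NeBot] (hl : l ≤ Bornology.cobounded ℂ) (k : ℕ) :
    ∀ {a₁ b₁ a₂ b₂ : ℕ → Matrix (Fin m) (Fin m) ℂ} {F₁ F₂ : ℂ → Matrix (Fin m) (Fin m) ℂ},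
    IsHalfLineData a₁ b₁ C₁ → IsHalfLineData a₂ b₂ C₂ →
    IsHalfLineWeyl a₁ b₁ F₁ → IsHalfLineWeyl a₂ b₂ F₂ → ∀ {n : ℤ},
    ((fun z => F₁ z - F₂ z) =O[l] fun z => ‖z‖ ^ (-n)) →
    (2 * k + 2 ≤ n → a₁ k = a₂ k) ∧ (2 * k + 3 ≤ n → b₁ k = b₂ k) := by
  induction k with
  | zero =>
    intro a₁ b₁ a₂ b₂ F₁ F₂ h₁ h₂ hF₁ hF₂ n hO
    refine ⟨fun hn => left_zero_eq hl h₁ h₂ hF₁ hF₂ (by simpa using hn) hO, fun hn => ?_⟩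
    push_cast at hn
    have ha := left_zero_eq hl h₁ h₂ hF₁ hF₂ (by omega) hO
    obtain ⟨G₁, hG₁⟩ := h₁.shift.exists_isHalfLineWeyl
    obtain ⟨G₂, hG₂⟩ := h₂.shift.exists_isHalfLineWeyl
    exact right_zero_eq hl h₁.shift h₂.shift hG₁ hG₂ (by omega)
      (isBigO_shift hl h₁ h₂ hF₁ hF₂ hG₁ hG₂ ha hO)
  | succ k ih =>
    intro a₁ b₁ a₂ b₂ F₁ F₂ h₁ h₂ hF₁ hF₂ n hO
    -- Below this threshold both conclusions at `k + 1` are vacuous; above it, `n - 2` is still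
    -- positive, so `b 0` is recovered and cancels.
    by_cases hn : 2 * (k : ℤ) + 4 ≤ n
    · have ha := left_zero_eq hl h₁ h₂ hF₁ hF₂ (by omega) hO
      obtain ⟨G₁, hG₁⟩ := h₁.shift.exists_isHalfLineWeyl
      obtain ⟨G₂, hG₂⟩ := h₂.shift.exists_isHalfLineWeyl
      have hO' := isBigO_shift hl h₁ h₂ hF₁ hF₂ hG₁ hG₂ ha hO
      have hb := right_zero_eq hl h₁.shift h₂.shift hG₁ hG₂ (by omega) hO'
      have := ih h₁.shift h₂.shift hG₁ hG₂ (n := n - 2) (by simpa [hb] using hO')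
      exact ⟨fun _ => this.1 (by omega), fun _ => this.2 (by push_cast at *; omega)⟩
    · push_cast
      exact ⟨fun _ => by omega, fun _ => by omega⟩

end HalfLine

/-! ### Weyl–Titchmarsh matrices as half-line Weyl functions -/

section Weyl

variable {m : ℕ} {A B : ℤ → Matrix (Fin m) (Fin m) ℂ} {z : ℂ} {k₀ : ℤ}

theorem IsJacobiData.exists_bound (h : IsJacobiData A B) :
    ∃ C : ℝ, 0 < C ∧ (∀ k, ‖A k‖ ≤ C) ∧ ∀ k, ‖B k‖ ≤ C := by
  obtain ⟨C, hC⟩ := h.bounded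
  refine ⟨max C 1, by positivity, fun k => ?_, fun k => ?_⟩
  · linarith [hC k, le_max_left C 1, norm_nonneg (B k)]
  · linarith [hC k, le_max_left C 1, norm_nonneg (A k)]

theorem IsJacobiData.exists_isHalfLineData (h : IsJacobiData A B) (f g : ℕ → ℤ) :
    ∃ C, IsHalfLineData (fun n => A (f n)) (fun n => B (g n)) C := by
  obtain ⟨C, h0, hA, hB⟩ := h.exists_bound
  exact ⟨C, fun _ => h.posDef _, h0, fun _ => hA _, fun _ => hB _⟩

theorem IsJacobiData.isUnit_det (h : IsJacobiData A B) (k : ℤ) : IsUnit (A k).det :=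
  (Matrix.isUnit_iff_isUnit_det _).1 (h.posDef k).isUnit

/-- The solution `θ - φ A(k₀)⁻¹ M`. -/
noncomputable def weylSolution (A B : ℤ → Matrix (Fin m) (Fin m) ℂ) (z : ℂ) (k₀ : ℤ)
    (M : Matrix (Fin m) (Fin m) ℂ) (k : ℤ) : Matrix (Fin m) (Fin m) ℂ :=
  thetaSolution A B z k₀ k - phiSolution A B z k₀ k * (A k₀)⁻¹ * M

theorem weylSolution_self (M : Matrix (Fin m) (Fin m) ℂ) : weylSolution A B z k₀ M k₀ = 1 := by
  simp [weylSolution, thetaSolution, phiSolution, jacobiSolution_zero]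

theorem weylSolution_succ (M : Matrix (Fin m) (Fin m) ℂ) :
    weylSolution A B z k₀ M (k₀ + 1) = -((A k₀)⁻¹ * M) := by
  simp [weylSolution, thetaSolution, phiSolution, jacobiSolution_one]

theorem isJacobiSolution_weylSolution (h : IsJacobiData A B) (M : Matrix (Fin m) (Fin m) ℂ) :
    IsJacobiSolution A B z (weylSolution A B z k₀ M) := by
  intro k
  have e1 : _ = _ := jacobiSolution_isJacobiSolution h z k₀ 1 0 k
  have e2 : _ = _ := congrArg (· * ((A k₀)⁻¹ * M)) (jacobiSolution_isJacobiSolution h z k₀ 0 1 k)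
  have e3 := congrArg₂ (· - ·) e1 e2
  simp only [zero_mul, sub_zero, add_mul] at e3
  rw [← e3]
  simp only [weylSolution, thetaSolution, phiSolution, mul_sub, mul_assoc]
  abel

theorem IsJacobiSolution.right {ψ : ℤ → Matrix (Fin m) (Fin m) ℂ}
    (h : IsJacobiSolution A B z ψ) (k₀ : ℤ) :
    IsHalfLineSolution (fun n => A (k₀ + n)) (fun n => B (k₀ + n + 1)) z
      (fun n => ψ (k₀ + n)) := by
  intro n
  have := h (k₀ + n + 1)
  rw [show k₀ + (n : ℤ) + 1 - 1 = k₀ + n by ring] at this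
  rw [← this]
  push_cast
  simp only [add_assoc, one_add_one_eq_two]
  abel

theorem IsJacobiSolution.left {ψ : ℤ → Matrix (Fin m) (Fin m) ℂ}
    (h : IsJacobiSolution A B z ψ) (k₀ : ℤ) :
    IsHalfLineSolution (fun n => A (k₀ - 1 - n)) (fun n => B (k₀ - n - 1)) z
      (fun n => ψ (k₀ - n)) := by
  intro n
  have := h (k₀ - n - 1)
  rw [show k₀ - (n : ℤ) - 1 + 1 = k₀ - n by ring] at this
  rw [← this]
  push_cast
  rw [show k₀ - 1 - (n : ℤ) = k₀ - n - 1 by ring,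
    show k₀ - 1 - ((n : ℤ) + 1) = k₀ - n - 1 - 1 by ring,
    show k₀ - ((n : ℤ) + 2) = k₀ - n - 1 - 1 by ring,
    show k₀ - ((n : ℤ) + 1) = k₀ - n - 1 by ring]

theorem isWeylMatrix_weylMatrix {S : Set ℤ} (h : ∃ M, IsWeylMatrix A B S z k₀ M) :
    IsWeylMatrix A B S z k₀ (weylMatrix A B S z k₀) := by
  rw [weylMatrix, dif_pos h]
  exact h.choose_spec

theorem IsWeylMatrix.exists_bound {S : Set ℤ} {M : Matrix (Fin m) (Fin m) ℂ}
    (h : IsWeylMatrix A B S z k₀ M) : ∃ K : ℝ, ∀ k ∈ S, ‖weylSolution A B z k₀ M k‖ ≤ K := by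
  refine ⟨√(∑' k : S, ‖weylSolution A B z k₀ M k‖ ^ 2), fun k hk => Real.le_sqrt_of_sq_le ?_⟩
  exact Summable.le_tsum (f := fun k : S => ‖weylSolution A B z k₀ M k‖ ^ 2) h ⟨k, hk⟩
    (fun _ _ => by positivity)

/-- The bounded solution decays geometrically, so a Weyl matrix exists; conversely, square
summability of the chosen one gives boundedness. The sign comes from `ψ (k₀ + 1) = -(A k₀)⁻¹ M`. -/
theorem isHalfLineWeyl_weylPlus (h : IsJacobiData A B) (k₀ : ℤ) :
    IsHalfLineWeyl (fun n => A (k₀ + n)) (fun n => B (k₀ + n + 1))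
      (fun z => -weylPlus A B z k₀) := by
  obtain ⟨C, hd⟩ := h.exists_isHalfLineData (fun n => k₀ + n) (fun n => k₀ + n + 1)
  filter_upwards [eventually_le_norm_cobounded (8 * C)] with z hz
  have hex : ∃ M, IsWeylMatrix A B (Set.Ioi k₀) z k₀ M := by
    obtain ⟨v, h1, h2, K, hK⟩ := hd.exists_bounded hz
    refine ⟨-(A k₀ * v 1), ?_⟩
    have e := IsHalfLineSolution.eq_of_initial hd
      ((isJacobiSolution_weylSolution (k₀ := k₀) h (-(A k₀ * v 1))).right k₀) h1
      (by simp [weylSolution_self, h2])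
      (by simp [weylSolution_succ, Matrix.nonsing_inv_mul_cancel_left _ _ (h.isUnit_det k₀)])
    have hs := (h1.summable_norm_sq hd hz hK).comp_injective
      (i := fun k : Set.Ioi k₀ => ((k : ℤ) - k₀).toNat) (fun x y hxy => by
        have := x.2; have := y.2; simp only [Set.mem_Ioi] at *; ext; omega)
    refine hs.congr fun k => ?_
    have hk := k.2
    simp only [Set.mem_Ioi] at hk
    change ‖v ((k : ℤ) - k₀).toNat‖ ^ 2 = _
    rw [← e, show k₀ + (((k : ℤ) - k₀).toNat : ℤ) = k by omega]
    rfl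
  have hM := isWeylMatrix_weylMatrix hex
  obtain ⟨K, hK⟩ := hM.exists_bound
  refine ⟨_, (isJacobiSolution_weylSolution (k₀ := k₀) h (weylPlus A B z k₀)).right k₀,
    -- The open half-line omits `k₀`, where the solution is 1.
    by simp [weylSolution_self], ⟨max K ‖(1 : Matrix (Fin m) (Fin m) ℂ)‖, fun n => ?_⟩, ?_⟩
  · cases n with
    | zero => simp [weylSolution_self]
    | succ n => exact (hK _ (by simp only [Set.mem_Ioi]; omega)).trans (le_max_left _ _)
  · simp [weylSolution_succ, Matrix.mul_nonsing_inv_cancel_left _ _ (h.isUnit_det k₀)]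

theorem mul_weylSolution_pred (h : IsJacobiData A B) (M : Matrix (Fin m) (Fin m) ℂ) :
    A (k₀ - 1) * weylSolution A B z k₀ M (k₀ - 1)
      = M - (B k₀ - z • (1 : Matrix (Fin m) (Fin m) ℂ)) := by
  have := isJacobiSolution_weylSolution (z := z) (k₀ := k₀) h M k₀
  rw [weylSolution_self, weylSolution_succ, mul_neg,
    Matrix.mul_nonsing_inv_cancel_left _ _ (h.isUnit_det k₀), mul_one] at this
  rw [← sub_eq_zero, ← this]
  abel

/-- `M` is normalized by the value at `k₀ + 1`, so the equation at `k₀` is needed to pass to `k₀ -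
1`; this introduces `B k₀ - z`. -/
theorem isHalfLineWeyl_weylMinus (h : IsJacobiData A B) (k₀ : ℤ) :
    IsHalfLineWeyl (fun n => A (k₀ - 1 - n)) (fun n => B (k₀ - n - 1))
      (fun z => weylMinus A B z k₀ - (B k₀ - z • (1 : Matrix (Fin m) (Fin m) ℂ))) := by
  obtain ⟨C, hd⟩ := h.exists_isHalfLineData (fun n => k₀ - 1 - n) (fun n => k₀ - n - 1)
  filter_upwards [eventually_le_norm_cobounded (8 * C)] with z hz
  have hex : ∃ M, IsWeylMatrix A B (Set.Iio k₀) z k₀ M := by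
    obtain ⟨v, h1, h2, K, hK⟩ := hd.exists_bounded hz
    refine ⟨A (k₀ - 1) * v 1 + (B k₀ - z • (1 : Matrix (Fin m) (Fin m) ℂ)), ?_⟩
    set M := A (k₀ - 1) * v 1 + (B k₀ - z • (1 : Matrix (Fin m) (Fin m) ℂ)) with hM
    have e1 := mul_weylSolution_pred (z := z) (k₀ := k₀) h M
    rw [hM, add_sub_cancel_right, ← hM] at e1
    have e2 := congrArg ((A (k₀ - 1))⁻¹ * ·) e1
    simp only [Matrix.nonsing_inv_mul_cancel_left _ _ (h.isUnit_det (k₀ - 1))] at e2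
    have e := IsHalfLineSolution.eq_of_initial hd
      ((isJacobiSolution_weylSolution (k₀ := k₀) h M).left k₀) h1
      (by simp [weylSolution_self, h2]) (by simpa using e2)
    have hs := (h1.summable_norm_sq hd hz hK).comp_injective
      (i := fun k : Set.Iio k₀ => (k₀ - (k : ℤ)).toNat) (fun x y hxy => by
        have := x.2; have := y.2; simp only [Set.mem_Iio] at *; ext; omega)
    refine hs.congr fun k => ?_
    have hk := k.2
    simp only [Set.mem_Iio] at hk
    change ‖v (k₀ - (k : ℤ)).toNat‖ ^ 2 = _
    rw [← e, show k₀ - ((k₀ - (k : ℤ)).toNat : ℤ) = k by omega]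
    rfl
  have hM := isWeylMatrix_weylMatrix hex
  obtain ⟨K, hK⟩ := hM.exists_bound
  refine ⟨_, (isJacobiSolution_weylSolution (k₀ := k₀) h (weylMinus A B z k₀)).left k₀,
    by simp [weylSolution_self], ⟨max K ‖(1 : Matrix (Fin m) (Fin m) ℂ)‖, fun n => ?_⟩, ?_⟩
  · cases n with
    | zero => simp [weylSolution_self]
    | succ n => exact (hK _ (by simp only [Set.mem_Iio]; omega)).trans (le_max_left _ _)
  · simpa using (mul_weylSolution_pred h (weylMinus A B z k₀)).symm

end Weyl

/-! ### The ray and the two-sided theorem -/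

theorem rayAtInfinity_le (α : ℝ) : rayAtInfinity α ≤ Bornology.cobounded ℂ := inf_le_left

theorem rayAtInfinity_neBot {α : ℝ} (hα : α ∈ Set.Ioc (-Real.pi) Real.pi) :
    (rayAtInfinity α).NeBot := by
  have ht : Tendsto (fun r : ℝ => (r : ℂ) * (Complex.cos α + Complex.sin α * Complex.I)) atTop
      (rayAtInfinity α) := by
    refine tendsto_inf.2 ⟨?_, tendsto_principal.2 ?_⟩
    · rw [← tendsto_norm_atTop_iff_cobounded]
      refine tendsto_atTop_mono' _ ?_ tendsto_id
      filter_upwards [eventually_gt_atTop 0] with r hr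
      rw [norm_mul, Complex.norm_cos_add_sin_mul_I, mul_one]
      simp [le_abs_self]
    · filter_upwards [eventually_gt_atTop 0] with r hr
      exact Complex.arg_mul_cos_add_sin_mul_I hr hα
  exact ht.neBot

theorem theorem4 (m : ℕ) (ε : ℝ) (hε₀ : 0 < ε) (hεπ : ε < Real.pi)
    (A₁ B₁ A₂ B₂ : ℤ → Matrix (Fin m) (Fin m) ℂ)
    (h₁ : IsJacobiData A₁ B₁) (h₂ : IsJacobiData A₂ B₂) (k₀ : ℤ) :
    (∀ N : ℕ, 2 ≤ N →
      ((fun z : ℂ => weylMinus A₁ B₁ z k₀ - weylMinus A₂ B₂ z k₀)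
        =O[rayAtInfinity (Real.pi - ε)] fun z : ℂ => ‖z‖ ^ (-(N : ℤ))) →
      (∀ k : ℕ, k ≤ N / 2 - 1 → A₁ (k₀ - 1 - k) = A₂ (k₀ - 1 - k)) ∧
      (∀ k : ℕ, k ≤ (N - 1) / 2 → B₁ (k₀ - k) = B₂ (k₀ - k))) ∧
    (∀ N : ℕ, 2 ≤ N →
      ((fun z : ℂ => weylPlus A₁ B₁ z k₀ - weylPlus A₂ B₂ z k₀)
        =O[rayAtInfinity (Real.pi - ε)] fun z : ℂ => ‖z‖ ^ (-(N : ℤ))) →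
      B₁ k₀ = B₂ k₀ →
      (∀ k : ℕ, k ≤ N / 2 - 1 → A₁ (k₀ + k) = A₂ (k₀ + k)) ∧
      (∀ k : ℕ, k ≤ (N - 1) / 2 → B₁ (k₀ + k) = B₂ (k₀ + k))) := by

  have hl := rayAtInfinity_le (Real.pi - ε)
  have := rayAtInfinity_neBot (α := Real.pi - ε) ⟨by linarith, by linarith⟩
  refine ⟨fun N hN hO => ?_, fun N hN hO hB => ?_⟩
  · obtain ⟨C₁, hd₁⟩ := h₁.exists_isHalfLineData (fun n => k₀ - 1 - n) (fun n => k₀ - n - 1)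
    obtain ⟨C₂, hd₂⟩ := h₂.exists_isHalfLineData (fun n => k₀ - 1 - n) (fun n => k₀ - n - 1)
    have hF₁ := isHalfLineWeyl_weylMinus h₁ k₀
    have hF₂ := isHalfLineWeyl_weylMinus h₂ k₀
    -- The terms `z` cancel in the difference, leaving `B k₀` as the constant at infinity.
    have hB : B₁ k₀ = B₂ k₀ := by
      refine IsHalfLineWeyl.right_zero_eq hl hd₁ hd₂ hF₁ hF₂ (n := N) (by omega) ?_
      refine hO.congr_left fun z => ?_
      abel
    have key := fun k => IsHalfLineWeyl.coeff_eq hl k hd₁ hd₂ hF₁ hF₂ (n := N)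
      (hO.congr_left fun z => by rw [hB]; abel)
    refine ⟨fun k hk => (key k).1 (by omega), fun k hk => ?_⟩
    -- Half-line `b k` sits at `k₀ - (k + 1)`, so `2 * k + 3 ≤ N` matches `k + 1 ≤ (N - 1) / 2`;
    -- index 0 is `hB`.
    cases k with
    | zero => simpa using hB
    | succ k =>
      have := (key k).2 (by omega)
      rwa [show k₀ - (k : ℤ) - 1 = k₀ - ((k + 1 : ℕ) : ℤ) by push_cast; ring] at this
  · obtain ⟨C₁, hd₁⟩ := h₁.exists_isHalfLineData (fun n => k₀ + n) (fun n => k₀ + n + 1)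
    obtain ⟨C₂, hd₂⟩ := h₂.exists_isHalfLineData (fun n => k₀ + n) (fun n => k₀ + n + 1)
    have key := fun k => IsHalfLineWeyl.coeff_eq hl k hd₁ hd₂ (isHalfLineWeyl_weylPlus h₁ k₀)
      (isHalfLineWeyl_weylPlus h₂ k₀) (n := N)
      (hO.neg_left.congr_left fun z => by abel)
    refine ⟨fun k hk => (key k).1 (by omega), fun k hk => ?_⟩
    cases k with
    | zero => simpa using hB
    | succ k =>
      have := (key k).2 (by omega)
      rwa [show k₀ + (k : ℤ) + 1 = k₀ + ((k + 1 : ℕ) : ℤ) by push_cast; ring] at this
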